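/- Let $f(x,\lambda)=x+\dfrac{\lambda}{(1+x)^2}$ and let $0<\lambda<\frac{4}{27}$. Then $f(\cdot,\lambda)$ has exactly two zeros $x_1(\lambda)<x_2(\lambda)$ in the interval $(-1,0)$. Put $s(\lambda)=\dfrac{\partial f}{\partial x}(x_2(\lambda),\lambda)$. For every $\alpha>2\sqrt{s(\lambda)}$, the stationary point $(x_1(\lambda),0)$ of the system $$\dot x=y,\qquad \dot y=-[\alpha y+f(x,\lambda)]$$ is a saddle, the stationary point $(x_2(\lambda),0)$ is a stable node (the Jacobian has, respectively, real eigenvalues of opposite signs and two negative real eigenvalues), and the system has a heteroclinic orbit from $(x_1(\lambda),0)$ to $(x_2(\lambda),0)$: there is a solution $(x(t),y(t))$, defined for all $t\in\mathbb{R}$ and with $x(t)>-1$ for all $t$, such that $(x(t),y(t))\to(x_1(\lambda),0)$ as $t\to-\infty$ and $(x(t),y(t))\to(x_2(\lambda),0)$ as $t\to\infty$. -/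

import Mathlib

open Filter Topology

noncomputable section

/-- The force `f(x, lam) = x + lam / (1 + x)^2`. -/
def springForce (x lam : ℝ) : ℝ := x + lam / (1 + x) ^ 2

/-- The planar vector field of `x' = y`, `y' = -(α y + f(x, lam))`. -/
def springField (α lam : ℝ) (p : ℝ × ℝ) : ℝ × ℝ :=
  (p.2, -(α * p.2 + springForce p.1 lam))

/-- The phase space `{(x, y) : x > -1}`, on which the vector field is smooth. -/
def springPhaseSpace : Set (ℝ × ℝ) := {p | -1 < p.1}

/-- `p` is a stationary point of the planar vector field `V`, and the characteristic polynomial of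
the Jacobian of `V` at `p` has the roots `μ` and `ν`, counted with multiplicity. -/
def HasLinearizationEigenvalues (V : ℝ × ℝ → ℝ × ℝ) (p : ℝ × ℝ) (μ ν : ℝ) : Prop :=
  V p = 0 ∧ DifferentiableAt ℝ V p ∧
    (fderiv ℝ V p : ℝ × ℝ →ₗ[ℝ] ℝ × ℝ).charpoly =
      (Polynomial.X - Polynomial.C μ) * (Polynomial.X - Polynomial.C ν)

/-- Saddle: the Jacobian has one negative and one positive eigenvalue. -/
def IsSaddlePoint (V : ℝ × ℝ → ℝ × ℝ) (p : ℝ × ℝ) : Prop :=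
  ∃ μ ν : ℝ, μ < 0 ∧ 0 < ν ∧ HasLinearizationEigenvalues V p μ ν

/-- Stable node: both eigenvalues of the Jacobian are real and negative. -/
def IsStableNode (V : ℝ × ℝ → ℝ × ℝ) (p : ℝ × ℝ) : Prop :=
  ∃ μ ν : ℝ, μ < 0 ∧ ν < 0 ∧ HasLinearizationEigenvalues V p μ ν

/-- `γ` is a solution of `γ' = V(γ)` in `U`, defined for all times, that tends to the stationary
point `p` as `t → -∞` and to the different stationary point `q` as `t → ∞`. -/
structure IsHeteroclinicOrbit (V : ℝ × ℝ → ℝ × ℝ) (U : Set (ℝ × ℝ)) (p q : ℝ × ℝ)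
    (γ : ℝ → ℝ × ℝ) : Prop where
  source_mem : p ∈ U
  target_mem : q ∈ U
  source_stationary : V p = 0
  target_stationary : V q = 0
  source_ne_target : p ≠ q
  mem : ∀ t, γ t ∈ U
  solution : ∀ t, HasDerivAt γ (V (γ t)) t
  tendsto_source : Tendsto γ atBot (𝓝 p)
  tendsto_target : Tendsto γ atTop (𝓝 q)

end

/-!
Write `g = -f(·, lam)`, which is positive and concave on `(x₁, x₂)` and vanishes at both ends. A
heteroclinic orbit along which `x` increases is the graph of a function `y = p x > 0` on `(x₁, x₂)`
with `p * p' = g - α * p`, and in terms of `q = p ^ 2 / 2` this reads `q' = g - α * √(2 q)`,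
`q x₁ = 0`. The right-hand side is continuous, though not Lipschitz, and decreasing in `q`. For such
equations a comparison principle holds (`le_of_deriv_le_of_lt`), and it makes the solutions of
Lipschitz approximations converge uniformly, so a solution exists on the whole of `[x₁, x₂]`
(`exists_forall_hasDerivAt_of_monotone`).

The comparison principle then locates the solution (`exists_phase_profile`). By concavity, `g` lies
below its tangents at `x₁` and `x₂`. The tangent at `x₁` makes `p = r / α * (x - x₁)`, with
`r = -f'(x₁)`, a supersolution. The tangent at `x₂` makes `p = α / 2 * (x₂ - x)` a supersolution,
because `α ^ 2 ≥ 4 * f'(x₂)`; this is where the hypothesis on `α` enters. Finally `p = δ * g` is a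
subsolution for small `δ > 0`, since `g'` is bounded above, so `p` is positive inside the interval.

It remains to solve the scalar equation `x' = p x`. As `p` is bounded by a multiple of the distance
to either endpoint, the travel time `∫ 1 / p` diverges at both ends, and its inverse is a
solution for all times that joins `x₁` to `x₂` (`exists_forall_hasDerivAt_of_le_mul_sub`).

The number and position of the zeros, and the signs of `f'` there, come from the factorisation of
the cubic `x * (1 + x) ^ 2 + lam`, whose third zero lies below `-1`.
-/

open Set

/-! ### Scalar equations with a right-hand side that decreases in the unknown -/

/-- A comparison principle in which the derivatives have to be ordered only where `v < u`. For
`u' = F(x, u)` and `v' = F(x, v)` with `F` decreasing in the unknown this is automatic, whether or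
not `F` is Lipschitz. -/
theorem le_of_deriv_le_of_lt {u v u' v' : ℝ → ℝ} {a b : ℝ}
    (hu : ContinuousOn u (Icc a b)) (hv : ContinuousOn v (Icc a b))
    (hu' : ∀ x ∈ Ioo a b, HasDerivAt u (u' x) x) (hv' : ∀ x ∈ Ioo a b, HasDerivAt v (v' x) x)
    (ha : u a ≤ v a) (h : ∀ x ∈ Ioo a b, v x < u x → u' x ≤ v' x) :
    ∀ x ∈ Icc a b, u x ≤ v x := by
  intro x hx
  by_contra! hlt
  -- The last point before `x` at which `u ≤ v`.
  set s : Set ℝ := {y | y ∈ Icc a x ∧ u y - v y ≤ 0} with hs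
  have hsub : Icc a x ⊆ Icc a b := Icc_subset_Icc_right hx.2
  have hd : ContinuousOn (fun y => u y - v y) (Icc a x) := (hu.mono hsub).sub (hv.mono hsub)
  have hclosed : IsClosed s := by
    have := hd.preimage_isClosed_of_isClosed isClosed_Icc (isClosed_Iic (a := (0 : ℝ)))
    exact this
  have hcomp : IsCompact s := isCompact_Icc.of_isClosed_subset hclosed fun y hy => hy.1
  have hne : s.Nonempty := ⟨a, ⟨le_rfl, hx.1⟩, sub_nonpos.2 ha⟩
  obtain ⟨c, hc⟩ := hcomp.exists_isGreatest hne
  have hcs := hc.1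
  have hcx : c < x := by
    rcases hcs.1.2.lt_or_eq with h1 | h1
    · exact h1
    · have := hcs.2
      rw [h1] at this
      linarith
  have hanti : AntitoneOn (fun y => u y - v y) (Icc c x) := by
    have hder : ∀ y ∈ Ioo c x, HasDerivAt (fun y => u y - v y) (u' y - v' y) y := by
      intro y hy
      have hy' : y ∈ Ioo a b := ⟨hcs.1.1.trans_lt hy.1, hy.2.trans_le hx.2⟩
      exact (hu' y hy').sub (hv' y hy')
    refine antitoneOn_of_deriv_nonpos (convex_Icc c x)
      (hd.mono (Icc_subset_Icc_left hcs.1.1)) ?_ ?_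
    · rw [interior_Icc]
      exact fun y hy => (hder y hy).differentiableAt.differentiableWithinAt
    · rw [interior_Icc]
      intro y hy
      rw [(hder y hy).deriv, sub_nonpos]
      refine h y ⟨hcs.1.1.trans_lt hy.1, hy.2.trans_le hx.2⟩ ?_
      by_contra! hle
      have := hc.2 (show y ∈ s from ⟨⟨hcs.1.1.trans hy.1.le, hy.2.le⟩, sub_nonpos.2 hle⟩)
      exact absurd hy.1 (not_lt.2 this)
  have h1 := hanti (left_mem_Icc.2 hcx.le) (right_mem_Icc.2 hcx.le) hcx.le
  have h2 := hcs.2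
  simp only at h1
  linarith

/-- The right-hand side is bounded, so the Picard–Lindelöf theorem applies on the whole interval, with
a ball that no solution can leave. -/
theorem exists_forall_hasDerivAt_of_lipschitzWith {g ψ : ℝ → ℝ} {a b C : ℝ} {K : NNReal}
    (hab : a ≤ b) (hg : ContinuousOn g (Icc a b)) (hψ : LipschitzWith K ψ)
    (hC : ∀ q, |ψ q| ≤ C) :
    ∃ q : ℝ → ℝ, ContinuousOn q (Icc a b) ∧ q a = 0 ∧
      ∀ x ∈ Ioo a b, HasDerivAt q (g x - ψ (q x)) x := by
  obtain ⟨G, hG⟩ := isCompact_Icc.exists_bound_of_continuousOn hg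
  have hG0 : 0 ≤ G := (norm_nonneg _).trans (hG a (left_mem_Icc.2 hab))
  have hC0 : 0 ≤ C := (abs_nonneg _).trans (hC 0)
  have hPL : IsPicardLindelof (fun x q => g x - ψ q)
      (⟨a, left_mem_Icc.2 hab⟩ : Icc a b) (0 : ℝ)
      (⟨(G + C) * (b - a), mul_nonneg (by positivity) (sub_nonneg.2 hab)⟩ : NNReal) 0
      (⟨G + C, by positivity⟩ : NNReal) K := by
    refine ⟨fun t _ => ?_, fun q _ => hg.sub continuousOn_const, fun t ht q _ => ?_, ?_⟩
    · refine LipschitzWith.lipschitzOnWith (LipschitzWith.of_dist_le_mul fun p q => ?_)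
      have := hψ.dist_le_mul p q
      rwa [dist_sub_left]
    · exact (norm_sub_le _ _).trans (add_le_add (hG t ht) (hC q))
    · simp only [max_eq_left (sub_nonneg.2 hab), sub_self, NNReal.coe_zero, sub_zero]
      exact le_rfl
  obtain ⟨q, hq0, hq⟩ := hPL.exists_eq_forall_mem_Icc_hasDerivWithinAt₀
  refine ⟨q, fun x hx => (hq x hx).continuousWithinAt, hq0, fun x hx => ?_⟩
  exact (hq x (Ioo_subset_Icc_self hx)).hasDerivAt (Icc_mem_nhds hx.1 hx.2)

/-- Existence for `q' = g x - φ q` with `φ` monotone, bounded and a uniform limit of Lipschitz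
functions. No limit of subsequences is needed: by monotonicity of `φ`, the solutions of the
approximating equations form a uniform Cauchy sequence. -/
theorem exists_forall_hasDerivAt_of_monotone {g φ : ℝ → ℝ} {a b C : ℝ} (hab : a ≤ b)
    (hg : ContinuousOn g (Icc a b)) (hmono : Monotone φ) (hC : ∀ q, |φ q| ≤ C)
    (happrox : ∀ ε > 0, ∃ ψ : ℝ → ℝ, ∃ K : NNReal, LipschitzWith K ψ ∧ ∀ q, |φ q - ψ q| ≤ ε) :
    ∃ q : ℝ → ℝ, ContinuousOn q (Icc a b) ∧ q a = 0 ∧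
      ∀ x ∈ Ioo a b, HasDerivAt q (g x - φ (q x)) x := by
  have hε : ∀ n : ℕ, (0 : ℝ) < 1 / ((n : ℝ) + 1) := fun n => Nat.one_div_pos_of_nat
  choose ψ K hψ hφψ using fun n : ℕ => happrox _ (hε n)
  have hψunif : TendstoUniformly ψ φ atTop := by
    rw [Metric.tendstoUniformly_iff]
    intro ε hε'
    filter_upwards [tendsto_one_div_add_atTop_nhds_zero_nat.eventually_lt_const hε'] with n hn q
    exact (hφψ n q).trans_lt hn
  have hφuc : UniformContinuous φ :=
    hψunif.uniformContinuous (Frequently.of_forall fun n => (hψ n).uniformContinuous)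
  have hψC : ∀ n q, |ψ n q| ≤ C + 1 / ((n : ℝ) + 1) := fun n q => by
    have h1 := abs_le.1 (hφψ n q)
    have h2 := abs_le.1 (hC q)
    exact abs_le.2 ⟨by linarith, by linarith⟩
  choose q hqc hq0 hq using fun n =>
    exists_forall_hasDerivAt_of_lipschitzWith hab hg (hψ n) (hψC n)
  -- The approximations need not be monotone: the error made in passing through `φ` is absorbed by
  -- the linear term.
  have hcmp : ∀ n m, ∀ x ∈ Icc a b,
      q n x ≤ q m x + (1 / ((n : ℝ) + 1) + 1 / ((m : ℝ) + 1)) * (x - a) := by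
    intro n m
    have hpos : 0 < 1 / ((n : ℝ) + 1) + 1 / ((m : ℝ) + 1) := add_pos (hε n) (hε m)
    refine le_of_deriv_le_of_lt (hqc n) ((hqc m).add (by fun_prop)) (hq n)
      (v' := fun x => g x - ψ m (q m x) + (1 / ((n : ℝ) + 1) + 1 / ((m : ℝ) + 1)) * 1)
      (fun x hx => (hq m x hx).add (((hasDerivAt_id x).sub_const a).const_mul _))
      (by simp [hq0]) ?_
    intro x hx hlt
    have hle : q m x ≤ q n x := by
      have := mul_nonneg hpos.le (sub_nonneg.2 hx.1.le)
      linarith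
    have h1 := hmono hle
    have h2 := abs_le.1 (hφψ n (q n x))
    have h3 := abs_le.1 (hφψ m (q m x))
    linarith
  have hdist : ∀ N : ℕ, ∀ n ≥ N, ∀ m ≥ N, ∀ x ∈ Icc a b,
      |q n x - q m x| ≤ 2 * (b - a) * (1 / ((N : ℝ) + 1)) := by
    intro N n hn m hm x hx
    have hn' : 1 / ((n : ℝ) + 1) ≤ 1 / ((N : ℝ) + 1) := Nat.one_div_le_one_div hn
    have hm' : 1 / ((m : ℝ) + 1) ≤ 1 / ((N : ℝ) + 1) := Nat.one_div_le_one_div hm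
    have hmul : (1 / ((n : ℝ) + 1) + 1 / ((m : ℝ) + 1)) * (x - a) ≤
        (1 / ((N : ℝ) + 1) + 1 / ((N : ℝ) + 1)) * (b - a) :=
      mul_le_mul (by linarith) (by linarith [hx.2]) (by linarith [hx.1])
        (by have := hε N; linarith)
    have h1 := hcmp n m x hx
    have h2 := hcmp m n x hx
    rw [add_comm (1 / ((m : ℝ) + 1))] at h2
    exact abs_le.2 ⟨by linarith, by linarith⟩
  have hcauchy : UniformCauchySeqOn q atTop (Icc a b) := by
    rw [Metric.uniformCauchySeqOn_iff]
    intro ε hε'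
    have ht : Tendsto (fun N : ℕ => 2 * (b - a) * (1 / ((N : ℝ) + 1))) atTop (𝓝 0) := by
      simpa using tendsto_one_div_add_atTop_nhds_zero_nat.const_mul (2 * (b - a))
    obtain ⟨N, hN⟩ := (ht.eventually_lt_const hε').exists
    exact ⟨N, fun m hm n hn x hx => (hdist N m hm n hn x hx).trans_lt hN⟩
  have hlim : ∀ x ∈ Icc a b, ∃ l, Tendsto (fun n => q n x) atTop (𝓝 l) := fun x hx =>
    cauchySeq_tendsto_of_complete (hcauchy.cauchySeq hx)
  choose! Q hQ using hlim
  have hunif : TendstoUniformlyOn q Q atTop (Icc a b) :=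
    hcauchy.tendstoUniformlyOn_of_tendsto hQ
  refine ⟨Q, hunif.continuousOn (Frequently.of_forall hqc), ?_, fun x hx => ?_⟩
  · have := hQ a (left_mem_Icc.2 hab)
    simp only [hq0] at this
    exact tendsto_nhds_unique this tendsto_const_nhds
  · refine hasDerivAt_of_tendstoUniformlyOn (s := Ioo a b) (f := q)
      (f' := fun n x => g x - ψ n (q n x)) (g' := fun x => g x - φ (Q x)) isOpen_Ioo ?_
      (Eventually.of_forall hq) (fun y hy => hQ y (Ioo_subset_Icc_self hy)) hx
    rw [Metric.tendstoUniformlyOn_iff]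
    intro ε hε'
    have h1 := Metric.tendstoUniformlyOn_iff.1
      (hφuc.comp_tendstoUniformlyOn hunif) (ε / 2) (half_pos hε')
    have h2 := Metric.tendstoUniformly_iff.1 hψunif (ε / 2) (half_pos hε')
    filter_upwards [h1, h2] with n hn1 hn2 y hy
    rw [dist_sub_left]
    have := dist_triangle (φ (Q y)) (φ (q n y)) (ψ n (q n y))
    have h3 := hn1 y (Ioo_subset_Icc_self hy)
    simp only [Function.comp] at h3
    linarith [hn2 (q n y)]

theorem exists_lipschitzWith_abs_sub_sqrt_le {ρ : ℝ → ℝ} {K : NNReal} (hρ : LipschitzWith K ρ)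
    (hρ0 : ∀ q, 0 ≤ ρ q) {α ε : ℝ} (hα : 0 < α) (hε : 0 < ε) :
    ∃ ψ : ℝ → ℝ, ∃ K' : NNReal, LipschitzWith K' ψ ∧ ∀ q, |α * √(ρ q) - ψ q| ≤ ε := by
  set η := ε / α with hη
  have hη0 : 0 < η := div_pos hε hα
  -- Replacing `√y` by `√(y + η ^ 2)` costs at most `η`.
  refine ⟨fun q => α * √(ρ q + η ^ 2), ⟨α / (2 * η) * K, by positivity⟩,
    LipschitzWith.of_dist_le_mul fun p q => ?_, fun q => ?_⟩
  · have hge : ∀ r, η ≤ √(ρ r + η ^ 2) := fun r =>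
      Real.le_sqrt_of_sq_le (by linarith [hρ0 r])
    have hsq : ∀ r, √(ρ r + η ^ 2) ^ 2 = ρ r + η ^ 2 := fun r =>
      Real.sq_sqrt (by have := hρ0 r; positivity)
    have h1 : |√(ρ p + η ^ 2) - √(ρ q + η ^ 2)| * (2 * η) ≤ |ρ p - ρ q| := by
      have : ρ p - ρ q = (√(ρ p + η ^ 2) - √(ρ q + η ^ 2)) *
          (√(ρ p + η ^ 2) + √(ρ q + η ^ 2)) := by
        linear_combination (hsq q) - (hsq p)
      rw [this, abs_mul]
      refine mul_le_mul_of_nonneg_left ?_ (abs_nonneg _)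
      exact le_trans (by linarith [hge p, hge q]) (le_abs_self _)
    have h2 : |ρ p - ρ q| ≤ K * |p - q| := hρ.dist_le_mul p q
    have h3 : |√(ρ p + η ^ 2) - √(ρ q + η ^ 2)| ≤ K * |p - q| / (2 * η) := by
      rw [le_div_iff₀ (by positivity)]
      exact h1.trans h2
    rw [Real.dist_eq, Real.dist_eq, ← mul_sub, abs_mul, abs_of_pos hα]
    calc α * |√(ρ p + η ^ 2) - √(ρ q + η ^ 2)| ≤ α * (K * |p - q| / (2 * η)) :=
          mul_le_mul_of_nonneg_left h3 hα.le
      _ = α / (2 * η) * K * |p - q| := by ring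
  · have h1 : √(ρ q) ≤ √(ρ q + η ^ 2) := Real.sqrt_le_sqrt (by nlinarith)
    have h2 : √(ρ q + η ^ 2) ≤ √(ρ q) + η := by
      rw [Real.sqrt_le_left (by positivity)]
      nlinarith [Real.sq_sqrt (hρ0 q), Real.sqrt_nonneg (ρ q)]
    rw [← mul_sub, abs_mul, abs_of_pos hα, abs_sub_comm, abs_of_nonneg (by linarith)]
    calc α * (√(ρ q + η ^ 2) - √(ρ q)) ≤ α * η :=
          mul_le_mul_of_nonneg_left (by linarith) hα.le
      _ = ε := by rw [hη]; field_simp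

/-! ### Orbits of a scalar field between two zeros -/

/-- The equation `x' = p x` is integrated by quadrature. The linear bounds at the endpoints make
the travel time to each of them infinite. -/
theorem exists_forall_hasDerivAt_of_le_mul_sub {p : ℝ → ℝ} {a b C : ℝ} (hab : a < b) (hC : 0 < C)
    (hp : ContinuousOn p (Ioo a b)) (hpos : ∀ x ∈ Ioo a b, 0 < p x)
    (ha : ∀ x ∈ Ioo a b, p x ≤ C * (x - a)) (hb : ∀ x ∈ Ioo a b, p x ≤ C * (b - x)) :
    ∃ X : ℝ → ℝ, (∀ t, X t ∈ Ioo a b) ∧ (∀ t, HasDerivAt X (p (X t)) t) ∧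
      Tendsto X atBot (𝓝 a) ∧ Tendsto X atTop (𝓝 b) := by
  obtain ⟨c, hc⟩ := exists_between hab
  have hcmem : c ∈ Ioo a b := hc
  have hinv : ContinuousOn (fun y => (p y)⁻¹) (Ioo a b) := hp.inv₀ fun x hx => (hpos x hx).ne'
  set T : ℝ → ℝ := fun x => ∫ y in c..x, (p y)⁻¹ with hT
  have hTd : ∀ x ∈ Ioo a b, HasDerivAt T (p x)⁻¹ x := by
    intro x hx
    have hsub : uIcc c x ⊆ Ioo a b := ordConnected_Ioo.uIcc_subset hcmem hx
    exact intervalIntegral.integral_hasDerivAt_right (hinv.mono hsub).intervalIntegrable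
      (hinv.stronglyMeasurableAtFilter isOpen_Ioo x hx)
      (hinv.continuousAt (isOpen_Ioo.mem_nhds hx))
  have hTc : ContinuousOn T (Ioo a b) := fun x hx => (hTd x hx).continuousAt.continuousWithinAt
  have hTmono : StrictMonoOn T (Ioo a b) := by
    refine strictMonoOn_of_deriv_pos (convex_Ioo a b) hTc fun x hx => ?_
    rw [interior_Ioo] at hx
    rw [(hTd x hx).deriv]
    exact inv_pos.2 (hpos x hx)
  -- Comparison with the travel times of `x' = C (b - x)` and `x' = C (x - a)`.
  have hlogb : MonotoneOn (fun x => T x + C⁻¹ * Real.log (b - x)) (Ioo a b) := by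
    have hder : ∀ x ∈ Ioo a b, HasDerivAt (fun x => T x + C⁻¹ * Real.log (b - x))
        ((p x)⁻¹ + C⁻¹ * (-1 / (b - x))) x := fun x hx =>
      (hTd x hx).add ((((hasDerivAt_id x).const_sub b).log (sub_pos.2 hx.2).ne').const_mul _)
    refine monotoneOn_of_deriv_nonneg (convex_Ioo a b)
      (fun x hx => (hder x hx).continuousAt.continuousWithinAt)
      (fun x hx => (hder x (interior_subset hx)).differentiableAt.differentiableWithinAt)
      fun x hx => ?_
    rw [interior_Ioo] at hx
    rw [(hder x hx).deriv]
    have h1 := inv_anti₀ (hpos x hx) (hb x hx)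
    rw [mul_inv] at h1
    rw [neg_div, one_div]
    linarith
  have hloga : MonotoneOn (fun x => T x - C⁻¹ * Real.log (x - a)) (Ioo a b) := by
    have hder : ∀ x ∈ Ioo a b, HasDerivAt (fun x => T x - C⁻¹ * Real.log (x - a))
        ((p x)⁻¹ - C⁻¹ * (1 / (x - a))) x := fun x hx =>
      (hTd x hx).sub ((((hasDerivAt_id x).sub_const a).log (sub_pos.2 hx.1).ne').const_mul _)
    refine monotoneOn_of_deriv_nonneg (convex_Ioo a b)
      (fun x hx => (hder x hx).continuousAt.continuousWithinAt)
      (fun x hx => (hder x (interior_subset hx)).differentiableAt.differentiableWithinAt)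
      fun x hx => ?_
    rw [interior_Ioo] at hx
    rw [(hder x hx).deriv]
    have h1 := inv_anti₀ (hpos x hx) (ha x hx)
    rw [mul_inv] at h1
    rw [one_div]
    linarith
  have htop : Tendsto T (𝓝[<] b) atTop := by
    have h0 : Tendsto (fun x => b - x) (𝓝[<] b) (𝓝[>] 0) := by
      refine tendsto_nhdsWithin_iff.2 ⟨?_, ?_⟩
      · have : Tendsto (fun x => b - x) (𝓝 b) (𝓝 (b - b)) :=
          Continuous.tendsto (by fun_prop) b
        rw [sub_self] at this
        exact this.mono_left nhdsWithin_le_nhds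
      · filter_upwards [self_mem_nhdsWithin] with x hx
        exact sub_pos.2 (mem_Iio.1 hx)
    have h1 : Tendsto (fun x => (T c + C⁻¹ * Real.log (b - c)) + C⁻¹ * -Real.log (b - x))
        (𝓝[<] b) atTop :=
      tendsto_atTop_add_const_left _ _ ((tendsto_neg_atBot_atTop.comp
        (Real.tendsto_log_nhdsGT_zero.comp h0)).const_mul_atTop (inv_pos.2 hC))
    refine tendsto_atTop_mono' _ ?_ h1
    filter_upwards [Ioo_mem_nhdsLT hc.2] with x hx
    have := hlogb hcmem ⟨hc.1.trans hx.1, hx.2⟩ hx.1.le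
    simp only at this
    linarith
  have hbot : Tendsto T (𝓝[>] a) atBot := by
    have h0 : Tendsto (fun x => x - a) (𝓝[>] a) (𝓝[>] 0) := by
      refine tendsto_nhdsWithin_iff.2 ⟨?_, ?_⟩
      · have : Tendsto (fun x => x - a) (𝓝 a) (𝓝 (a - a)) :=
          Continuous.tendsto (by fun_prop) a
        rw [sub_self] at this
        exact this.mono_left nhdsWithin_le_nhds
      · filter_upwards [self_mem_nhdsWithin] with x hx
        exact sub_pos.2 (mem_Ioi.1 hx)
    have h1 : Tendsto (fun x => (T c - C⁻¹ * Real.log (c - a)) + C⁻¹ * Real.log (x - a))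
        (𝓝[>] a) atBot :=
      tendsto_atBot_add_const_left _ _ ((Real.tendsto_log_nhdsGT_zero.comp h0).const_mul_atBot
        (inv_pos.2 hC))
    refine tendsto_atBot_mono' _ ?_ h1
    filter_upwards [Ioo_mem_nhdsGT hc.1] with x hx
    have := hloga ⟨hx.1, hx.2.trans hc.2⟩ hcmem hx.2.le
    simp only at this
    linarith
  have hsurj : SurjOn T (Ioo a b) univ := by
    refine hTc.surjOn_of_tendsto ⟨c, hcmem⟩ ?_ ?_
    · exact (tendsto_comp_coe_Ioo_atBot hab).2 hbot
    · exact (tendsto_comp_coe_Ioo_atTop hab).2 htop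
  choose X hX hTX using fun t : ℝ => hsurj (mem_univ t)
  have hXT : ∀ x ∈ Ioo a b, X (T x) = x := fun x hx => hTmono.injOn (hX _) hx (hTX _)
  have hXmono : Monotone X := fun s t hst => by
    rw [← hTmono.le_iff_le (hX s) (hX t), hTX, hTX]
    exact hst
  have hXc : ∀ t, ContinuousAt X t := fun t => by
    refine continuousAt_of_monotoneOn_of_image_mem_nhds (s := univ) (hXmono.monotoneOn _)
      univ_mem (mem_of_superset (isOpen_Ioo.mem_nhds (hX t)) fun x hx => ?_)
    exact ⟨T x, mem_univ _, hXT x hx⟩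
  refine ⟨X, hX, fun t => ?_, ?_, ?_⟩
  · have := HasDerivAt.of_local_left_inverse (hXc t) (hTd _ (hX t))
      (inv_ne_zero (hpos _ (hX t)).ne') (Eventually.of_forall hTX)
    rwa [inv_inv] at this
  · refine tendsto_order.2 ⟨fun y hy => Eventually.of_forall fun t => hy.trans (hX t).1,
      fun y hy => ?_⟩
    obtain ⟨z, hz1, hz2⟩ := exists_between (lt_min hy hab)
    have hz : z ∈ Ioo a b := ⟨hz1, hz2.trans_le (min_le_right _ _)⟩
    filter_upwards [eventually_le_atBot (T z)] with t ht
    have := hXmono ht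
    rw [hXT z hz] at this
    exact this.trans_lt (hz2.trans_le (min_le_left _ _))
  · refine tendsto_order.2 ⟨fun y hy => ?_,
      fun y hy => Eventually.of_forall fun t => (hX t).2.trans hy⟩
    obtain ⟨z, hz1, hz2⟩ := exists_between (max_lt hy hab)
    have hz : z ∈ Ioo a b := ⟨(le_max_right _ _).trans_lt hz1, hz2⟩
    filter_upwards [eventually_ge_atTop (T z)] with t ht
    have := hXmono ht
    rw [hXT z hz] at this
    exact ((le_max_left _ _).trans_lt hz1).trans_le this

/-! ### The phase profile of a monotone front -/

/-- If `g` vanishes at `a` and lies below lines through `(a, 0)` and `(b, 0)` with slopes `r` and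
`-s`, where `4 * s ≤ α ^ 2`, then `p * p' = g - α * p` has a positive solution on `(a, b)` that
vanishes at least linearly at both endpoints. -/
theorem exists_phase_profile {g g' : ℝ → ℝ} {a b α r s B : ℝ} (hab : a < b) (hα : 0 < α)
    (hB : 0 ≤ B) (hs : 4 * s ≤ α ^ 2)
    (hg : ContinuousOn g (Icc a b)) (hg' : ∀ x ∈ Ioo a b, HasDerivAt g (g' x) x)
    (hga : g a = 0) (hpos : ∀ x ∈ Ioo a b, 0 < g x)
    (hr : ∀ x ∈ Ioo a b, g x ≤ r * (x - a)) (hsb : ∀ x ∈ Ioo a b, g x ≤ s * (b - x))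
    (hgB : ∀ x ∈ Ioo a b, g' x ≤ B) :
    ∃ p : ℝ → ℝ, ∀ x ∈ Ioo a b, 0 < p x ∧ p x ≤ r / α * (x - a) ∧ p x ≤ α / 2 * (b - x) ∧
      HasDerivAt p (g x / p x - α) x := by
  have hr0 : 0 < r := by
    obtain ⟨c, hc⟩ := exists_between hab
    have := (hpos c hc).trans_le (hr c hc)
    exact pos_of_mul_pos_left this (sub_pos.2 hc.1).le
  set m := r / α with hm
  have hm0 : 0 < m := div_pos hr0 hα
  have hmα : α * m = r := by rw [hm]; field_simp
  -- `M` bounds `p ^ 2` for both supersolutions, so cutting off `2 q` at `M`, which makes the equation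
  -- bounded, does not affect the comparison with them.
  set M := ((m + α / 2) * (b - a)) ^ 2 with hM
  have hba := sub_pos.2 hab
  set ρ : ℝ → ℝ := fun q => min (max (2 * q) 0) M with hρ
  have hM0 : 0 ≤ M := sq_nonneg _
  have hρ0 : ∀ q, 0 ≤ ρ q := fun q => le_min (le_max_right _ _) hM0
  have hρM : ∀ q, ρ q ≤ M := fun q => min_le_right _ _
  have hρmono : Monotone ρ := fun p q hpq =>
    min_le_min_right _ (max_le_max_right _ (by linarith))
  have hρlip : LipschitzWith 2 ρ := by
    refine LipschitzWith.min_const (LipschitzWith.max_const ?_ _) _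
    refine LipschitzWith.of_dist_le_mul fun p q => ?_
    rw [Real.dist_eq, Real.dist_eq, ← mul_sub, abs_mul]
    simp
  -- If `w ^ 2 ≤ M` then `√(ρ (w ^ 2 / 2)) = w`.
  have hρsq : ∀ w, 0 ≤ w → w ≤ (m + α / 2) * (b - a) → √(ρ (w ^ 2 / 2)) = w := by
    intro w hw hwM
    have h1 : ρ (w ^ 2 / 2) = w ^ 2 := by
      have h2 : 2 * (w ^ 2 / 2) = w ^ 2 := by ring
      simp only [hρ, h2]
      rw [max_eq_left (sq_nonneg w), min_eq_left (pow_le_pow_left₀ hw hwM 2)]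
    rw [h1, Real.sqrt_sq hw]
  obtain ⟨q, hqc, hqa, hq⟩ := exists_forall_hasDerivAt_of_monotone (φ := fun y => α * √(ρ y))
    (C := α * √M) hab.le hg
    (fun p q hpq => mul_le_mul_of_nonneg_left (Real.sqrt_le_sqrt (hρmono hpq)) hα.le)
    (fun y => by
      rw [abs_of_nonneg (by positivity)]
      exact mul_le_mul_of_nonneg_left (Real.sqrt_le_sqrt (hρM y)) hα.le)
    (fun ε hε => exists_lipschitzWith_abs_sub_sqrt_le hρlip hρ0 hα hε)
  have hupa : ∀ x ∈ Icc a b, q x ≤ (m * (x - a)) ^ 2 / 2 := by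
    refine le_of_deriv_le_of_lt hqc (by fun_prop) hq
      (v' := fun x => m ^ 2 * (x - a)) (fun x _ => ?_) (by simp [hqa]) fun x hx hlt => ?_
    · have := (((((hasDerivAt_id x).sub_const a).const_mul m).pow 2).div_const 2)
      refine this.congr_deriv ?_
      simp
      ring
    · have hxa := sub_pos.2 hx.1
      have h1 := Real.sqrt_le_sqrt (hρmono hlt.le)
      rw [hρsq _ (by positivity)
        (mul_le_mul (by linarith) (by linarith [hx.2]) hxa.le (by positivity))] at h1
      have h2 := mul_le_mul_of_nonneg_left h1 hα.le
      rw [← mul_assoc, hmα] at h2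
      have h3 := hr x hx
      have : 0 ≤ m ^ 2 * (x - a) := by positivity
      linarith
  have hupb : ∀ x ∈ Icc a b, q x ≤ (α / 2 * (b - x)) ^ 2 / 2 := by
    refine le_of_deriv_le_of_lt hqc (by fun_prop) hq
      (v' := fun x => -((α / 2) ^ 2 * (b - x))) (fun x _ => ?_)
      (by rw [hqa]; positivity) fun x hx hlt => ?_
    · have := (((((hasDerivAt_id x).const_sub b).const_mul (α / 2)).pow 2).div_const 2)
      refine this.congr_deriv ?_
      simp
      ring
    · have hxb := sub_pos.2 hx.2
      have h1 := Real.sqrt_le_sqrt (hρmono hlt.le)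
      rw [hρsq _ (by positivity)
        (mul_le_mul (by linarith) (by linarith [hx.1]) hxb.le (by positivity))] at h1
      have h2 := mul_le_mul_of_nonneg_left h1 hα.le
      have h3 := hsb x hx
      have h4 := mul_le_mul_of_nonneg_right hs hxb.le
      nlinarith
  -- `δ` is chosen so that `δ ^ 2 * g' + α * δ ≤ 1`.
  set δ := (B + α + 1)⁻¹ with hδ
  have hδ0 : 0 < δ := by positivity
  have hδ1 : δ * (B + α + 1) = 1 := inv_mul_cancel₀ (by positivity)
  have hδle : δ ≤ 1 := inv_le_one_of_one_le₀ (by linarith)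
  have hlow : ∀ x ∈ Icc a b, (δ * g x) ^ 2 / 2 ≤ q x := by
    refine le_of_deriv_le_of_lt (by fun_prop) hqc (u' := fun x => δ ^ 2 * g x * g' x)
      (fun x hx => ?_) hq (by simp [hga, hqa]) fun x hx hlt => ?_
    · have := ((((hg' x hx).const_mul δ).pow 2).div_const 2)
      refine this.congr_deriv ?_
      simp
      ring
    · have hgx := hpos x hx
      have h1 : √(ρ (q x)) ≤ δ * g x := by
        rw [Real.sqrt_le_left (by positivity)]
        exact (min_le_left _ _).trans (max_le (by linarith) (by positivity))
      have h2 : δ ^ 2 * g' x + α * δ ≤ 1 := by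
        have h3 := mul_le_mul_of_nonneg_left (hgB x hx) (sq_nonneg δ)
        nlinarith [mul_nonneg hδ0.le hB]
      have h3 := mul_le_mul_of_nonneg_left h1 hα.le
      have h4 := mul_le_mul_of_nonneg_right h2 hgx.le
      linarith
  refine ⟨fun x => √(2 * q x), fun x hx => ?_⟩
  have hx' := Ioo_subset_Icc_self hx
  have hxa := sub_pos.2 hx.1
  have hxb := sub_pos.2 hx.2
  have hgx := hpos x hx
  have hqpos : 0 < 2 * q x := by
    have h1 := hlow x hx'
    have : 0 < (δ * g x) ^ 2 := by positivity
    linarith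
  have hpb : √(2 * q x) ≤ α / 2 * (b - x) := by
    rw [Real.sqrt_le_left (by positivity)]
    linarith [hupb x hx']
  have hppos := Real.sqrt_pos.2 hqpos
  have hρq : √(ρ (q x)) = √(2 * q x) := by
    have h1 := hρsq _ hppos.le (hpb.trans (mul_le_mul (by linarith) (by linarith [hx.1]) hxb.le
      (by positivity)))
    rw [Real.sq_sqrt hqpos.le] at h1
    rwa [mul_div_cancel_left₀ _ two_ne_zero] at h1
  refine ⟨hppos, ?_, hpb, ?_⟩
  · rw [Real.sqrt_le_left (by positivity)]
    linarith [hupa x hx']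
  · have h1 := ((hq x hx).const_mul 2).sqrt hqpos.ne'
    refine h1.congr_deriv ?_
    simp only [hρq]
    field_simp

/-! ### The force and its zeros -/

theorem hasDerivAt_springForce {x : ℝ} (lam : ℝ) (hx : -1 < x) :
    HasDerivAt (fun x => springForce x lam) (1 - 2 * lam / (1 + x) ^ 3) x := by
  have h0 : 1 + x ≠ 0 := by linarith
  have h1 := (hasDerivAt_id x).add
    ((hasDerivAt_const x lam).div (((hasDerivAt_id x).const_add 1).pow 2) (pow_ne_zero 2 h0))
  refine h1.congr_deriv ?_
  simp only [id, Pi.pow_apply, zero_mul, Nat.cast_ofNat]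
  field_simp
  ring

/-- Convexity of the force: the difference to the tangent at `c` is
`lam * (x - c) ^ 2 * (3 + 2 * x + c) / ((1 + x) ^ 2 * (1 + c) ^ 3)`. -/
theorem springForce_tangent_le {lam x c : ℝ} (hlam : 0 < lam) (hx : -1 < x) (hc : -1 < c) :
    springForce c lam + (1 - 2 * lam / (1 + c) ^ 3) * (x - c) ≤ springForce x lam := by
  have hu : 0 < 1 + x := by linarith
  have hv : 0 < 1 + c := by linarith
  have key : springForce x lam - (springForce c lam + (1 - 2 * lam / (1 + c) ^ 3) * (x - c)) =
      lam * (x - c) ^ 2 * (2 * (1 + x) + (1 + c)) / ((1 + x) ^ 2 * (1 + c) ^ 3) := by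
    unfold springForce
    field_simp
    ring
  have : 0 ≤ lam * (x - c) ^ 2 * (2 * (1 + x) + (1 + c)) / ((1 + x) ^ 2 * (1 + c) ^ 3) := by
    positivity
  linarith

theorem springForce_eq_div {x : ℝ} (lam : ℝ) (hx : -1 < x) :
    springForce x lam = (x * (1 + x) ^ 2 + lam) / (1 + x) ^ 2 := by
  have h0 : 1 + x ≠ 0 := by linarith
  unfold springForce
  field_simp

theorem springForce_eq_zero_iff {lam x : ℝ} (hx : -1 < x) :
    springForce x lam = 0 ↔ x * (1 + x) ^ 2 + lam = 0 := by
  have h0 : (1 + x) ^ 2 ≠ 0 := pow_ne_zero 2 (by linarith)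
  rw [springForce_eq_div lam hx, div_eq_zero_iff, or_iff_left h0]

/-- The cubic `x * (1 + x) ^ 2 + lam` is positive at `-1` and `0` and negative at its minimum `-1 / 3`,
where `lam = 4 / 27` is the threshold. The last conjunct says that its third zero, `-2 - x₁ - x₂`,
lies below `-1`. -/
theorem exists_springForce_zeros {lam : ℝ} (hlam : 0 < lam) (hlam' : lam < 4 / 27) :
    ∃ x₁ x₂ : ℝ, -1 < x₁ ∧ x₁ < -1 / 3 ∧ -1 / 3 < x₂ ∧ x₂ < 0 ∧
      (∀ x, x * (1 + x) ^ 2 + lam = (x - x₁) * (x - x₂) * (x + 2 + x₁ + x₂)) ∧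
      0 < 1 + x₁ + x₂ := by
  have hcont : Continuous fun x : ℝ => x * (1 + x) ^ 2 + lam := by fun_prop
  obtain ⟨x₁, h₁, e₁⟩ := intermediate_value_Ioo' (by norm_num : (-1 : ℝ) ≤ -1 / 3)
    hcont.continuousOn (show (0 : ℝ) ∈ Ioo _ _ from ⟨by norm_num; linarith, by norm_num; linarith⟩)
  obtain ⟨x₂, h₂, e₂⟩ := intermediate_value_Ioo (by norm_num : (-1 / 3 : ℝ) ≤ 0)
    hcont.continuousOn (show (0 : ℝ) ∈ Ioo _ _ from ⟨by norm_num; linarith, by norm_num; linarith⟩)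
  simp only at e₁ e₂
  have hne : x₁ - x₂ ≠ 0 := by linarith [h₁.2, h₂.1]
  have hrel : x₁ ^ 2 + x₁ * x₂ + x₂ ^ 2 + 2 * (x₁ + x₂) + 1 = 0 := by
    refine mul_left_cancel₀ hne ?_
    linear_combination e₁ - e₂
  have hfac : ∀ x, x * (1 + x) ^ 2 + lam = (x - x₁) * (x - x₂) * (x + 2 + x₁ + x₂) := by
    intro x
    linear_combination e₁ + (x - x₁) * hrel
  refine ⟨x₁, x₂, h₁.1, h₁.2, h₂.1, h₂.2, hfac, ?_⟩
  have h3 := hfac (-1)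
  have h4 : 0 < (1 + x₁) * (1 + x₂) := mul_pos (by linarith [h₁.1]) (by linarith [h₂.1])
  refine pos_of_mul_pos_right (a := (1 + x₁) * (1 + x₂)) ?_ h4.le
  linarith

/-! ### Linearization at the stationary points -/

theorem hasFDerivAt_springField (α lam : ℝ) {x : ℝ} (hx : -1 < x) (y : ℝ) :
    HasFDerivAt (springField α lam)
      (LinearMap.toContinuousLinearMap
        (Matrix.toLin (Module.Basis.finTwoProd ℝ) (Module.Basis.finTwoProd ℝ)
          !![0, 1; -(1 - 2 * lam / (1 + x) ^ 3), -α])) (x, y) := by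
  rw [Matrix.toLin_finTwoProd_toContinuousLinearMap]
  have hf : HasFDerivAt (fun p : ℝ × ℝ => springForce p.1 lam)
      ((1 - 2 * lam / (1 + x) ^ 3) • ContinuousLinearMap.fst ℝ ℝ ℝ) (x, y) :=
    HasDerivAt.comp_hasFDerivAt (x := (x, y)) (h₂ := fun z => springForce z lam) (f := Prod.fst)
      (hasDerivAt_springForce lam hx) hasFDerivAt_fst
  have hs : HasFDerivAt (Prod.snd : ℝ × ℝ → ℝ) (ContinuousLinearMap.snd ℝ ℝ ℝ) (x, y) :=
    hasFDerivAt_snd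
  refine (hs.prodMk ((hs.const_mul α).add hf).neg).congr_fderiv ?_
  ext <;> simp

/-- The characteristic polynomial at a stationary point `(x, 0)` is `X ^ 2 + α * X + f'(x)`. -/
theorem hasLinearizationEigenvalues_springField {α lam x μ ν : ℝ} (hx : -1 < x)
    (hx0 : springForce x lam = 0) (hsum : μ + ν = -α)
    (hprod : μ * ν = 1 - 2 * lam / (1 + x) ^ 3) :
    HasLinearizationEigenvalues (springField α lam) (x, 0) μ ν := by
  have hd := hasFDerivAt_springField α lam hx 0
  refine ⟨by simp [springField, hx0], hd.differentiableAt, ?_⟩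
  rw [hd.fderiv, LinearMap.coe_toContinuousLinearMap,
    ← LinearMap.charpoly_toMatrix _ (Module.Basis.finTwoProd ℝ), LinearMap.toMatrix_toLin,
    Matrix.charpoly_fin_two, Matrix.trace_fin_two_of, Matrix.det_fin_two_of, ← hprod, zero_add,
    ← hsum]
  simp only [Polynomial.C_add, Polynomial.C_mul, zero_mul, one_mul, zero_sub, neg_neg]
  ring

theorem isSaddlePoint_springField {α lam x : ℝ} (hx : -1 < x) (hx0 : springForce x lam = 0)
    (hneg : 1 - 2 * lam / (1 + x) ^ 3 < 0) : IsSaddlePoint (springField α lam) (x, 0) := by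
  set f' := 1 - 2 * lam / (1 + x) ^ 3 with hf'
  have hsq : √(α ^ 2 - 4 * f') ^ 2 = α ^ 2 - 4 * f' :=
    Real.sq_sqrt (by linarith [sq_nonneg α])
  have hlt : |α| < √(α ^ 2 - 4 * f') := Real.lt_sqrt_of_sq_lt (by rw [sq_abs]; linarith)
  obtain ⟨h1, h2⟩ := abs_lt.1 hlt
  refine ⟨(-α - √(α ^ 2 - 4 * f')) / 2, (-α + √(α ^ 2 - 4 * f')) / 2, by linarith, by linarith,
    hasLinearizationEigenvalues_springField hx hx0 (by ring) ?_⟩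
  linear_combination -hsq / 4

theorem isStableNode_springField {α lam x : ℝ} (hx : -1 < x) (hx0 : springForce x lam = 0)
    (hα : 0 < α) (hpos : 0 < 1 - 2 * lam / (1 + x) ^ 3)
    (hdisc : 4 * (1 - 2 * lam / (1 + x) ^ 3) ≤ α ^ 2) :
    IsStableNode (springField α lam) (x, 0) := by
  set f' := 1 - 2 * lam / (1 + x) ^ 3 with hf'
  have hsq : √(α ^ 2 - 4 * f') ^ 2 = α ^ 2 - 4 * f' := Real.sq_sqrt (by linarith)
  have hlt : √(α ^ 2 - 4 * f') < α := (Real.sqrt_lt' hα).2 (by linarith)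
  have h0 := Real.sqrt_nonneg (α ^ 2 - 4 * f')
  refine ⟨(-α - √(α ^ 2 - 4 * f')) / 2, (-α + √(α ^ 2 - 4 * f')) / 2, by linarith, by linarith,
    hasLinearizationEigenvalues_springField hx hx0 (by ring) ?_⟩
  linear_combination -hsq / 4

/-! ### The heteroclinic orbit -/

theorem exists_isHeteroclinicOrbit_springField {α lam x₁ x₂ : ℝ} (hlam : 0 < lam) (hα : 0 < α)
    (h₁ : -1 < x₁) (h₁₂ : x₁ < x₂) (e₁ : springForce x₁ lam = 0) (e₂ : springForce x₂ lam = 0)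
    (hneg : ∀ x ∈ Ioo x₁ x₂, springForce x lam < 0)
    (hs : 4 * (1 - 2 * lam / (1 + x₂) ^ 3) ≤ α ^ 2) :
    ∃ γ : ℝ → ℝ × ℝ,
      IsHeteroclinicOrbit (springField α lam) springPhaseSpace (x₁, 0) (x₂, 0) γ := by
  have hu₁ : 0 < 1 + x₁ := by linarith
  obtain ⟨p, hp⟩ := exists_phase_profile (g := fun x => -springForce x lam)
    (g' := fun x => -(1 - 2 * lam / (1 + x) ^ 3)) (r := -(1 - 2 * lam / (1 + x₁) ^ 3))
    (B := 2 * lam / (1 + x₁) ^ 3) h₁₂ hα (by positivity) hs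
    (fun x hx => (hasDerivAt_springForce lam
      (h₁.trans_le hx.1)).neg.continuousAt.continuousWithinAt)
    (fun x hx => (hasDerivAt_springForce lam (h₁.trans hx.1)).neg) (by simp [e₁])
    (fun x hx => neg_pos.2 (hneg x hx))
    (fun x hx => by
      have := springForce_tangent_le hlam (h₁.trans hx.1) h₁
      linarith)
    (fun x hx => by
      have := springForce_tangent_le hlam (h₁.trans hx.1) (h₁.trans h₁₂)
      linarith)
    (fun x hx => by
      have : 2 * lam / (1 + x) ^ 3 ≤ 2 * lam / (1 + x₁) ^ 3 := by
        have := hx.1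
        gcongr
      linarith)
  set m := -(1 - 2 * lam / (1 + x₁) ^ 3) / α
  obtain ⟨X, hX, hXd, hXbot, hXtop⟩ := exists_forall_hasDerivAt_of_le_mul_sub (p := p)
    (C := max m (α / 2)) h₁₂ (lt_max_of_lt_right (half_pos hα))
    (fun x hx => (hp x hx).2.2.2.continuousAt.continuousWithinAt) (fun x hx => (hp x hx).1)
    (fun x hx => (hp x hx).2.1.trans
      (mul_le_mul_of_nonneg_right (le_max_left _ _) (sub_pos.2 hx.1).le))
    (fun x hx => (hp x hx).2.2.1.trans
      (mul_le_mul_of_nonneg_right (le_max_right _ _) (sub_pos.2 hx.2).le))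
  refine ⟨fun t => (X t, p (X t)), h₁, h₁.trans h₁₂, by simp [springField, e₁],
    by simp [springField, e₂], fun h => h₁₂.ne (congrArg Prod.fst h), fun t => h₁.trans (hX t).1,
    fun t => ?_, ?_, ?_⟩
  · have h := hp _ (hX t)
    refine (hXd t).prodMk ((h.2.2.2.comp t (hXd t)).congr_deriv ?_)
    have := h.1.ne'
    simp only
    field_simp
    ring
  · refine hXbot.prodMk_nhds (squeeze_zero (fun t => (hp _ (hX t)).1.le)
      (fun t => (hp _ (hX t)).2.1) ?_)
    simpa using (hXbot.sub_const x₁).const_mul m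
  · refine hXtop.prodMk_nhds (squeeze_zero (fun t => (hp _ (hX t)).1.le)
      (fun t => (hp _ (hX t)).2.2.1) ?_)
    simpa using (hXtop.const_sub x₂).const_mul (α / 2)

theorem proposition5 (lam : ℝ) (hlam : 0 < lam) (hlam' : lam < 4 / 27) :
    ∃ x₁ x₂ : ℝ, x₁ < x₂ ∧
      {x : ℝ | -1 < x ∧ x < 0 ∧ springForce x lam = 0} = {x₁, x₂} ∧
      ∀ α : ℝ, 2 * Real.sqrt (deriv (fun x => springForce x lam) x₂) < α →
        IsSaddlePoint (springField α lam) (x₁, 0) ∧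
        IsStableNode (springField α lam) (x₂, 0) ∧
        ∃ γ : ℝ → ℝ × ℝ,
          IsHeteroclinicOrbit (springField α lam) springPhaseSpace (x₁, 0) (x₂, 0) γ := by
  obtain ⟨x₁, x₂, h₁, h₁', h₂', h₂, hfac, hsum⟩ := exists_springForce_zeros hlam hlam'
  have h₁₂ : x₁ < x₂ := h₁'.trans h₂'
  have h₂₁ : -1 < x₂ := h₁.trans h₁₂
  have e₁ : springForce x₁ lam = 0 := (springForce_eq_zero_iff h₁).2 (by rw [hfac]; ring)
  have e₂ : springForce x₂ lam = 0 := (springForce_eq_zero_iff h₂₁).2 (by rw [hfac]; ring)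
  -- At a zero `c` of the force, `lam = -c (1 + c) ^ 2`.
  have hderiv : ∀ c, -1 < c → springForce c lam = 0 →
      1 - 2 * lam / (1 + c) ^ 3 = (1 + 3 * c) / (1 + c) := by
    intro c hc hc0
    have h0 : 1 + c ≠ 0 := by linarith
    have := (springForce_eq_zero_iff hc).1 hc0
    field_simp
    linear_combination -2 * this
  refine ⟨x₁, x₂, h₁₂, ?_, fun α hα => ?_⟩
  · ext x
    simp only [mem_ofPred_eq, mem_insert_iff, mem_singleton_iff]
    constructor
    · rintro ⟨hx, -, hx0⟩
      have h := (springForce_eq_zero_iff hx).1 hx0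
      rw [hfac] at h
      have h3 : x + 2 + x₁ + x₂ ≠ 0 := by linarith
      rcases mul_eq_zero.1 ((mul_eq_zero.1 h).resolve_right h3) with h | h
      · exact Or.inl (sub_eq_zero.1 h)
      · exact Or.inr (sub_eq_zero.1 h)
    · rintro (rfl | rfl)
      · exact ⟨h₁, by linarith, e₁⟩
      · exact ⟨h₂₁, h₂, e₂⟩
  rw [(hasDerivAt_springForce lam h₂₁).deriv] at hα
  have hs : 0 < 1 - 2 * lam / (1 + x₂) ^ 3 := by
    rw [hderiv x₂ h₂₁ e₂]
    exact div_pos (by linarith) (by linarith)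
  have hr : 1 - 2 * lam / (1 + x₁) ^ 3 < 0 := by
    rw [hderiv x₁ h₁ e₁]
    exact div_neg_of_neg_of_pos (by linarith) (by linarith)
  have hα0 : 0 < α := lt_of_le_of_lt (by positivity) hα
  have hdisc : 4 * (1 - 2 * lam / (1 + x₂) ^ 3) ≤ α ^ 2 := by
    have h := pow_le_pow_left₀ (by positivity) hα.le 2
    rw [mul_pow, Real.sq_sqrt hs.le] at h
    linarith
  refine ⟨isSaddlePoint_springField h₁ e₁ hr, isStableNode_springField h₂₁ e₂ hα0 hs hdisc,
    exists_isHeteroclinicOrbit_springField hlam hα0 h₁ h₁₂ e₁ e₂ (fun x hx => ?_) hdisc⟩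
  have hx : -1 < x ∧ x₁ < x ∧ x < x₂ := ⟨h₁.trans hx.1, hx.1, hx.2⟩
  have h0 : 0 < (1 + x) ^ 2 := pow_pos (by linarith) 2
  rw [springForce_eq_div lam hx.1, hfac]
  exact div_neg_of_neg_of_pos (mul_neg_of_neg_of_pos
    (mul_neg_of_pos_of_neg (by linarith) (by linarith)) (by linarith)) h0
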